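/- For an open set $U\subset\mathbb{C}^n$ let $A^2(U)$ be the Bergman space of square integrable (with respect to Lebesgue measure) holomorphic functions on $U$, $P_U:L^2(U)\to A^2(U)$ the orthogonal projection, and $K^U(w,z)=K^U_z(w)$ the Bergman kernel, i.e. $K^U_z\in A^2(U)$ and $f(z)=\langle f,K^U_z\rangle$ for all $f\in A^2(U)$ and $z\in U$. Let $\mathcal{Z}_U=\{z\in U: K^U(z,z)=0\}$, and for $z\in U\setminus\mathcal{Z}_U$ let $k^U_z=K^U_z/\sqrt{K^U(z,z)}$. The Berezin transform of a bounded linear operator $T$ on $A^2(U)$ is $B_UT(z)=\langle Tk^U_z,k^U_z\rangle$, $z\in U\setminus\mathcal{Z}_U$. For $\phi\in L^\infty(U)$ the Toeplitz operator $T_\phi$ on $A^2(U)$ is $T_\phi f=P_U(\phi f)$. $E$ denotes extension of functions by zero to $\mathbb{C}^n$. **Corollary.** Let $\Omega$ and $\Omega_j$ ($j\geq 1$) be domains (non-empty connected open sets) in $\mathbb{C}^n$ such that $A^2(\Omega)\neq\{0\}$ and $\Omega\subset\Omega_{j+1}\subset\Omega_j$ for all $j$. Assume that $K^{\Omega_j}(z,z)\to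 K^{\Omega}(z,z)$ as $j\to\infty$ for every $z\in\Omega$. Let $l$ and $k_1,\dots,k_l$ be nonnegative integers (an empty sum being $0$ and an empty product the identity), let $\phi_{m,i}\in L^\infty(\Omega_1)$ for $1\le m\le l$, $1\le i\le k_m$, and define \[T=\sum_{m=1}^{l}T_{\phi_{m,1}|_{\Omega}}\cdots T_{\phi_{m,k_m}|_{\Omega}}\ \text{ on } A^2(\Omega),\qquad T^{\Omega_j}=\sum_{m=1}^{l}T_{\phi_{m,1}|_{\Omega_j}}\cdots T_{\phi_{m,k_m}|_{\Omega_j}}\ \text{ on } A^2(\Omega_j).\] Then: 1. For every compact set $K\subset\Omega\setminus\mathcal{Z}_\Omega$ one has $K\cap\mathcal{Z}_{\Omega_j}=\emptyset$ for all sufficiently large $j$ (so that $B_{\Omega_j}T^{\Omega_j}$ is defined on $K$), and $B_{\Omega_j}T^{\Omega_j}\to B_\Omega T$ uniformly on $K$ as $j\to\infty$. 2. If, in addition, $\Omega_1$ is bounded, then for every $0<p<\infty$ the functions $EB_{\Omega_j}T^{\Omega_j}$ and $B_\Omega T$ belong to $L^p(\Omega)$ and $EB_{\Omega_j}T^{\Omega_j}\to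 B_\Omega T$ in $L^p(\Omega)$ as $j\to\infty$. -/

import Mathlib

open MeasureTheory Filter Topology
open scoped ENNReal InnerProductSpace

/-! ### Auxiliary facts on holomorphic functions of several variables -/

/-- Rotating all coordinates by a unimodular number preserves Lebesgue measure on `ℂⁿ`. -/
theorem measurePreserving_smul_circle {n : ℕ} (c : Circle) :
    MeasurePreserving (fun a : Fin n → ℂ => (c : ℂ) • a) volume volume := by
  have h := volume_preserving_pi (α' := fun _ : Fin n => ℂ) (β' := fun _ : Fin n => ℂ)
    (f := fun _ w => (c : ℂ) * w)
    (fun _ => (rotation c).measurePreserving)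
  exact h

/-- The mean value property of holomorphic functions over closed balls (polydiscs) of `ℂⁿ`. -/
theorem integral_closedBall_of_differentiableOn {n : ℕ} {Ω : Set (Fin n → ℂ)}
    {g : (Fin n → ℂ) → ℂ} (hg : DifferentiableOn ℂ g Ω) {z : Fin n → ℂ} {r : ℝ}
    (hzr : Metric.closedBall z r ⊆ Ω) :
    ∫ a in Metric.closedBall (0 : Fin n → ℂ) r, g (z + a) =
      (volume.real (Metric.closedBall (0 : Fin n → ℂ) r) : ℂ) * g z := by
  set B := Metric.closedBall (0 : Fin n → ℂ) r with hB
  have hmap : ∀ (c : ℂ), ‖c‖ ≤ 1 → ∀ a ∈ B, z + c • a ∈ Ω := by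
    intro c hc a ha
    apply hzr
    rw [hB, mem_closedBall_zero_iff] at ha
    rw [Metric.mem_closedBall, dist_eq_norm, add_sub_cancel_left, norm_smul]
    nlinarith [norm_nonneg a, norm_nonneg c]
  -- the circle average of each slice
  have hslice : ∀ a ∈ B, Real.circleAverage (fun w : ℂ => g (z + w • a)) 0 1 = g z := by
    intro a ha
    have := DiffContOnCl.circleAverage (f := fun w : ℂ => g (z + w • a)) (c := 0) (R := 1) ?_
    · simpa using this
    · apply DifferentiableOn.diffContOnCl
      rw [abs_one, closure_ball _ one_ne_zero]
      refine hg.comp (by fun_prop) ?_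
      intro w hw
      exact hmap w (by simpa using hw) a ha
  -- invariance under rotations
  have hrot : ∀ θ : ℝ, ∫ a in B, g (z + circleMap 0 1 θ • a) = ∫ a in B, g (z + a) := by
    intro θ
    have hmp := measurePreserving_smul_circle (n := n) (Circle.exp θ)
    have hemb : MeasurableEmbedding (fun a : Fin n → ℂ => (Circle.exp θ : ℂ) • a) :=
      (Homeomorph.smulOfNeZero (Circle.exp θ : ℂ) (Circle.coe_ne_zero _)).measurableEmbedding
    have h := hmp.setIntegral_preimage_emb hemb (fun a => g (z + a)) B
    have hpre : (fun a : Fin n → ℂ => (Circle.exp θ : ℂ) • a) ⁻¹' B = B := by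
      ext a
      simp [hB, norm_smul]
    rw [hpre] at h
    rw [← h]
    simp [circleMap, Circle.coe_exp]
  have hswap : ∫ θ in (0 : ℝ)..2 * Real.pi, ∫ a in B, g (z + circleMap 0 1 θ • a) =
      ∫ a in B, ∫ θ in (0 : ℝ)..2 * Real.pi, g (z + circleMap 0 1 θ • a) := by
    apply intervalIntegral_integral_swap
    rw [Measure.prod_restrict]
    have hc : ContinuousOn (Function.uncurry fun (θ : ℝ) (a : Fin n → ℂ) =>
        g (z + circleMap 0 1 θ • a)) (Set.Icc 0 (2 * Real.pi) ×ˢ B) := by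
      refine hg.continuousOn.comp (by fun_prop) ?_
      rintro ⟨θ, a⟩ ⟨-, ha⟩
      exact hmap _ (by simp) a ha
    have hi := hc.integrableOn_compact (μ := volume.prod volume)
      (isCompact_Icc.prod (isCompact_closedBall _ _))
    refine hi.mono_set (Set.prod_mono ?_ le_rfl)
    rw [Set.uIoc_of_le (by positivity)]
    exact Set.Ioc_subset_Icc_self
  simp_rw [hrot] at hswap
  rw [intervalIntegral.integral_const] at hswap
  have h2 : ∫ a in B, ∫ θ in (0 : ℝ)..2 * Real.pi, g (z + circleMap 0 1 θ • a) =
      ∫ a in B, ((2 * Real.pi : ℝ) : ℂ) * g z := by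
    refine setIntegral_congr_fun Metric.isClosed_closedBall.measurableSet ?_
    intro a ha
    have := hslice a ha
    rw [Real.circleAverage_def] at this
    simp only [← this]
    rw [Complex.real_smul]
    have hpi : (Real.pi : ℂ) ≠ 0 := by exact_mod_cast Real.pi_ne_zero
    push_cast
    field_simp
  rw [h2, setIntegral_const, sub_zero, Complex.real_smul, Complex.real_smul] at hswap
  have hpi : ((2 * Real.pi : ℝ) : ℂ) ≠ 0 := by
    exact_mod_cast (by positivity : (2 * Real.pi : ℝ) ≠ 0)
  apply mul_left_cancel₀ hpi
  rw [hswap]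
  ring

/-- Point evaluations of holomorphic functions are controlled by the `L²` norm. -/
theorem exists_norm_le_of_differentiableOn (n : ℕ) {r : ℝ} (hr : 0 < r) :
    ∃ C : ℝ, 0 ≤ C ∧ ∀ (Ω : Set (Fin n → ℂ)), IsOpen Ω →
      ∀ (g : (Fin n → ℂ) → ℂ), DifferentiableOn ℂ g Ω →
      ∀ f : Lp ℂ 2 ((volume : Measure (Fin n → ℂ)).restrict Ω),
        f =ᵐ[volume.restrict Ω] g →
      ∀ z, Metric.closedBall z r ⊆ Ω → ‖g z‖ ≤ C * ‖f‖ := by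
  set B := Metric.closedBall (0 : Fin n → ℂ) r with hB
  have hV : 0 < volume.real B := by
    refine ENNReal.toReal_pos (Metric.measure_closedBall_pos _ _ hr).ne' ?_
    exact (isCompact_closedBall _ _).measure_lt_top.ne
  have hfin : volume B ≠ ∞ := (isCompact_closedBall _ _).measure_lt_top.ne
  refine ⟨(volume.real B)⁻¹ * (volume B ^ (1 / (2 : ℝ))).toReal, by positivity, ?_⟩
  intro Ω hΩ g hg f hfg z hz
  have hmean := integral_closedBall_of_differentiableOn hg hz
  rw [← hB] at hmean
  have htr : MeasurePreserving (fun a : Fin n → ℂ => z + a) volume volume :=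
    measurePreserving_add_left volume z
  have hemb : MeasurableEmbedding (fun a : Fin n → ℂ => z + a) :=
    (Homeomorph.addLeft z).measurableEmbedding
  have hpre : (fun a : Fin n → ℂ => z + a) ⁻¹' Metric.closedBall z r = B := by
    ext a; simp [hB]
  have hvol : volume (Metric.closedBall z r) = volume B := by
    rw [← hpre, htr.measure_preimage Metric.isClosed_closedBall.measurableSet.nullMeasurableSet]
  have h1 := htr.setIntegral_preimage_emb hemb g (Metric.closedBall z r)
  rw [hpre] at h1
  rw [h1] at hmean
  have hm : AEStronglyMeasurable g (volume.restrict (Metric.closedBall z r)) :=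
    (hg.continuousOn.mono hz).aestronglyMeasurable Metric.isClosed_closedBall.measurableSet
  have h2 : ‖∫ a in Metric.closedBall z r, g a‖ₑ ≤
      eLpNorm g 2 (volume.restrict Ω) * volume B ^ (1 / (2 : ℝ)) := by
    calc ‖∫ a in Metric.closedBall z r, g a‖ₑ
        ≤ ∫⁻ a in Metric.closedBall z r, ‖g a‖ₑ := enorm_integral_le_lintegral_enorm _
      _ = eLpNorm g 1 (volume.restrict (Metric.closedBall z r)) := by
          rw [eLpNorm_one_eq_lintegral_enorm]
      _ ≤ eLpNorm g 2 (volume.restrict (Metric.closedBall z r)) *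
          (volume.restrict (Metric.closedBall z r)) Set.univ ^ (1 / (2 : ℝ)) := by
          have := eLpNorm_le_eLpNorm_mul_rpow_measure_univ (p := 1) (q := 2)
            (by norm_num) hm
          convert this using 3
          norm_num
      _ ≤ _ := by
          rw [Measure.restrict_apply_univ, hvol]
          gcongr
  have h3 : eLpNorm g 2 (volume.restrict Ω) = ‖f‖ₑ := by
    rw [Lp.enorm_def, eLpNorm_congr_ae hfg]
  rw [h3, hmean] at h2
  have h4 := ENNReal.toReal_mono (by finiteness) h2
  rw [ENNReal.toReal_mul, toReal_enorm, toReal_enorm, norm_mul, Complex.norm_real,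
    Real.norm_of_nonneg hV.le] at h4
  rw [mul_assoc, inv_mul_eq_div, le_div_iff₀ hV]
  linarith

/-- Local control of values and derivatives of holomorphic functions by the `L²` norm. -/
theorem exists_local_bound {n : ℕ} {Ω : Set (Fin n → ℂ)} (hΩ : IsOpen Ω) {z₀ : Fin n → ℂ}
    (hz₀ : z₀ ∈ Ω) :
    ∃ r > 0, ∃ M : ℝ, 0 ≤ M ∧ Metric.ball z₀ r ⊆ Ω ∧
      ∀ (g : (Fin n → ℂ) → ℂ), DifferentiableOn ℂ g Ω →
      ∀ f : Lp ℂ 2 ((volume : Measure (Fin n → ℂ)).restrict Ω),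
        f =ᵐ[volume.restrict Ω] g →
      ∀ z ∈ Metric.ball z₀ r, ‖g z‖ ≤ M * ‖f‖ ∧ ‖fderiv ℂ g z‖ ≤ M * ‖f‖ := by
  obtain ⟨R, hR, hball⟩ := Metric.isOpen_iff.1 hΩ z₀ hz₀
  have hr : 0 < R / 4 := by positivity
  obtain ⟨C, hC, hb⟩ := exists_norm_le_of_differentiableOn n hr
  have hsub : Metric.ball z₀ (R / 4) ⊆ Ω :=
    (Metric.ball_subset_ball (by linarith)).trans hball
  refine ⟨R / 4, hr, max C (2 * C / (R / 4)), le_max_of_le_left hC, hsub, ?_⟩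
  intro g hg f hfg
  have hval : ∀ z ∈ Metric.ball z₀ (2 * (R / 4)), ‖g z‖ ≤ C * ‖f‖ := by
    intro z hz
    refine hb Ω hΩ g hg f hfg z (subset_trans ?_ hball)
    intro w hw
    rw [Metric.mem_closedBall] at hw
    rw [Metric.mem_ball] at hz ⊢
    linarith [dist_triangle w z z₀]
  intro z hz
  constructor
  · refine (hval z (Metric.ball_subset_ball (by linarith) hz)).trans ?_
    gcongr
    exact le_max_left _ _
  · have hsub' : Metric.ball z (R / 4) ⊆ Metric.ball z₀ (2 * (R / 4)) := by
      intro w hw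
      rw [Metric.mem_ball] at *
      linarith [dist_triangle w z z₀]
    have h := Complex.norm_fderiv_le_div_of_mapsTo_ball (f := g) (c := z) (R₁ := R / 4)
      (R₂ := 2 * C * ‖f‖)
      (hg.mono (hsub'.trans ((Metric.ball_subset_ball (by linarith)).trans hball))) ?_ hr
    · refine h.trans ?_
      rw [mul_div_right_comm]
      gcongr
      exact le_max_right _ _
    · intro w hw
      rw [Metric.mem_closedBall, dist_eq_norm]
      have h1 := hval w (hsub' hw)
      have h2 := hval z (hsub' (Metric.mem_ball_self hr))
      linarith [norm_sub_le (g w) (g z)]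

/-! ### Bergman spaces -/

/-- The Bergman space `A²(Ω)`, as a subspace of `L²(Ω)` (Lebesgue measure on `ℂⁿ`): the classes
of square integrable functions that have a representative holomorphic on `Ω`. -/
def bergmanSpace {n : ℕ} (Ω : TopologicalSpace.Opens (Fin n → ℂ)) :
    Submodule ℂ (Lp ℂ 2 ((volume : Measure (Fin n → ℂ)).restrict (Ω : Set (Fin n → ℂ)))) where
  carrier := {f | ∃ g : (Fin n → ℂ) → ℂ, DifferentiableOn ℂ g Ω ∧
    f =ᵐ[volume.restrict (Ω : Set (Fin n → ℂ))] g}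
  add_mem' := by
    rintro f₁ f₂ ⟨g₁, hg₁, h₁⟩ ⟨g₂, hg₂, h₂⟩
    exact ⟨g₁ + g₂, hg₁.add hg₂, (Lp.coeFn_add f₁ f₂).trans (h₁.add h₂)⟩
  zero_mem' := ⟨0, differentiableOn_const 0, Lp.coeFn_zero _ _ _⟩
  smul_mem' := by
    rintro c f ⟨g, hg, h⟩
    exact ⟨c • g, hg.const_smul c, (Lp.coeFn_smul c f).trans (h.const_smul c)⟩

/-- The holomorphic representative of `f ∈ A²(Ω)`; its values on `Ω` are determined by `f`. -/
noncomputable def bergmanRep {n : ℕ} {Ω : TopologicalSpace.Opens (Fin n → ℂ)}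
    (f : bergmanSpace Ω) : (Fin n → ℂ) → ℂ :=
  f.2.choose

theorem differentiableOn_bergmanRep {n : ℕ} {Ω : TopologicalSpace.Opens (Fin n → ℂ)}
    (f : bergmanSpace Ω) : DifferentiableOn ℂ (bergmanRep f) Ω :=
  f.2.choose_spec.1

theorem ae_eq_bergmanRep {n : ℕ} {Ω : TopologicalSpace.Opens (Fin n → ℂ)} (f : bergmanSpace Ω) :
    (f : Lp ℂ 2 ((volume : Measure (Fin n → ℂ)).restrict (Ω : Set (Fin n → ℂ))))
      =ᵐ[volume.restrict (Ω : Set (Fin n → ℂ))] bergmanRep f :=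
  f.2.choose_spec.2

theorem bergmanRep_eq {n : ℕ} {Ω : TopologicalSpace.Opens (Fin n → ℂ)} (f : bergmanSpace Ω)
    {g : (Fin n → ℂ) → ℂ} (hg : DifferentiableOn ℂ g Ω)
    (h : (f : Lp ℂ 2 ((volume : Measure (Fin n → ℂ)).restrict (Ω : Set (Fin n → ℂ))))
      =ᵐ[volume.restrict (Ω : Set (Fin n → ℂ))] g) :
    Set.EqOn (bergmanRep f) g Ω :=
  Measure.eqOn_open_of_ae_eq ((ae_eq_bergmanRep f).symm.trans h) Ω.isOpen
    (differentiableOn_bergmanRep f).continuousOn hg.continuousOn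

theorem bergmanRep_add {n : ℕ} {Ω : TopologicalSpace.Opens (Fin n → ℂ)} (f₁ f₂ : bergmanSpace Ω) :
    Set.EqOn (bergmanRep (f₁ + f₂)) (bergmanRep f₁ + bergmanRep f₂) Ω :=
  bergmanRep_eq _ ((differentiableOn_bergmanRep f₁).add (differentiableOn_bergmanRep f₂))
    ((Lp.coeFn_add _ _).trans ((ae_eq_bergmanRep f₁).add (ae_eq_bergmanRep f₂)))

theorem bergmanRep_smul {n : ℕ} {Ω : TopologicalSpace.Opens (Fin n → ℂ)} (c : ℂ)
    (f : bergmanSpace Ω) : Set.EqOn (bergmanRep (c • f)) (c • bergmanRep f) Ω :=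
  bergmanRep_eq _ ((differentiableOn_bergmanRep f).const_smul c)
    ((Lp.coeFn_smul _ _).trans ((ae_eq_bergmanRep f).const_smul c))

theorem bergmanRep_sub {n : ℕ} {Ω : TopologicalSpace.Opens (Fin n → ℂ)} (f₁ f₂ : bergmanSpace Ω) :
    Set.EqOn (bergmanRep (f₁ - f₂)) (bergmanRep f₁ - bergmanRep f₂) Ω :=
  bergmanRep_eq _ ((differentiableOn_bergmanRep f₁).sub (differentiableOn_bergmanRep f₂))
    ((Lp.coeFn_sub _ _).trans ((ae_eq_bergmanRep f₁).sub (ae_eq_bergmanRep f₂)))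

/-- `A²(Ω)` is a closed subspace of `L²(Ω)`. -/
theorem isClosed_bergmanSpace {n : ℕ} (Ω : TopologicalSpace.Opens (Fin n → ℂ)) :
    IsClosed (bergmanSpace Ω : Set
      (Lp ℂ 2 ((volume : Measure (Fin n → ℂ)).restrict (Ω : Set (Fin n → ℂ))))) := by
  apply IsSeqClosed.isClosed
  intro F f hF hlim
  lift F to ℕ → bergmanSpace Ω using hF
  have hcau : CauchySeq (fun k => (F k : Lp ℂ 2 (volume.restrict (Ω : Set (Fin n → ℂ))))) :=
    hlim.cauchySeq
  -- uniform Cauchy property of values and derivatives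
  have hkey : ∀ z₀ ∈ Ω, ∃ r > 0, Metric.ball z₀ r ⊆ (Ω : Set (Fin n → ℂ)) ∧
      ∀ ε > 0, ∃ N, ∀ k ≥ N, ∀ l ≥ N, ∀ z ∈ Metric.ball z₀ r,
        ‖bergmanRep (F k) z - bergmanRep (F l) z‖ < ε ∧
        ‖fderiv ℂ (bergmanRep (F k)) z - fderiv ℂ (bergmanRep (F l)) z‖ < ε := by
    intro z₀ hz₀
    obtain ⟨r, hr, M, hM, hsub, hb⟩ := exists_local_bound Ω.isOpen hz₀
    refine ⟨r, hr, hsub, fun ε hε => ?_⟩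
    obtain ⟨N, hN⟩ := Metric.cauchySeq_iff.1 hcau (ε / (M + 1)) (by positivity)
    refine ⟨N, fun k hk l hl z hz => ?_⟩
    have hd := hN k hk l hl
    rw [dist_eq_norm] at hd
    have hdk := (differentiableOn_bergmanRep (F k)).differentiableAt (Ω.isOpen.mem_nhds (hsub hz))
    have hdl := (differentiableOn_bergmanRep (F l)).differentiableAt (Ω.isOpen.mem_nhds (hsub hz))
    obtain ⟨h1, h2⟩ := hb (bergmanRep (F k) - bergmanRep (F l))
      ((differentiableOn_bergmanRep (F k)).sub (differentiableOn_bergmanRep (F l)))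
      (F k - F l) ((Lp.coeFn_sub _ _).trans ((ae_eq_bergmanRep _).sub (ae_eq_bergmanRep _))) z hz
    rw [fderiv_sub hdk hdl] at h2
    have hlt : M * ‖(F k - F l : Lp ℂ 2 (volume.restrict (Ω : Set (Fin n → ℂ))))‖ < ε := by
      rw [lt_div_iff₀ (by positivity)] at hd
      nlinarith [norm_nonneg (F k - F l : Lp ℂ 2 (volume.restrict (Ω : Set (Fin n → ℂ))))]
    exact ⟨h1.trans_lt hlt, h2.trans_lt hlt⟩
  have hval : ∀ z ∈ Ω, ∃ w, Tendsto (fun k => bergmanRep (F k) z) atTop (𝓝 w) := by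
    intro z hz
    obtain ⟨r, hr, -, h⟩ := hkey z hz
    apply cauchySeq_tendsto_of_complete
    refine Metric.cauchySeq_iff.2 fun ε hε => ?_
    obtain ⟨N, hN⟩ := h ε hε
    exact ⟨N, fun k hk l hl => by
      rw [dist_eq_norm]; exact (hN k hk l hl z (Metric.mem_ball_self hr)).1⟩
  have hder : ∀ z ∈ Ω, ∃ A, Tendsto (fun k => fderiv ℂ (bergmanRep (F k)) z) atTop (𝓝 A) := by
    intro z hz
    obtain ⟨r, hr, -, h⟩ := hkey z hz
    apply cauchySeq_tendsto_of_complete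
    refine Metric.cauchySeq_iff.2 fun ε hε => ?_
    obtain ⟨N, hN⟩ := h ε hε
    exact ⟨N, fun k hk l hl => by
      rw [dist_eq_norm]; exact (hN k hk l hl z (Metric.mem_ball_self hr)).2⟩
  choose! G hG using hval
  choose! A hA using hder
  refine ⟨G, fun z hz => ?_, ?_⟩
  · obtain ⟨r, hr, hsub, h⟩ := hkey z hz
    have hmem : Metric.ball z r ∈ 𝓝 z := Metric.ball_mem_nhds z hr
    refine (hasFDerivAt_of_tendstoUniformlyOnFilter (l := atTop) (g' := A)
      (f' := fun k => fderiv ℂ (bergmanRep (F k))) (f := fun k => bergmanRep (F k))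
      ?_ ?_ ?_).differentiableAt.differentiableWithinAt
    · apply UniformCauchySeqOnFilter.tendstoUniformlyOnFilter_of_tendsto
      · apply UniformCauchySeqOn.uniformCauchySeqOnFilter _ |>.mono_right
          (le_principal_iff.2 hmem)
        refine Metric.uniformCauchySeqOn_iff.2 fun ε hε => ?_
        obtain ⟨N, hN⟩ := h ε hε
        exact ⟨N, fun k hk l hl x hx => by
          rw [dist_eq_norm]; exact (hN k hk l hl x hx).2⟩
      · filter_upwards [hmem] with x hx using hA x (hsub hx)
    · have : ∀ᶠ p : ℕ × (Fin n → ℂ) in atTop ×ˢ 𝓝 z, p.2 ∈ Metric.ball z r :=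
        tendsto_snd.eventually hmem
      filter_upwards [this] with p hp
      exact ((differentiableOn_bergmanRep (F p.1)).differentiableAt
        (Ω.isOpen.mem_nhds (hsub hp))).hasFDerivAt
    · filter_upwards [hmem] with x hx using hG x (hsub hx)
  · obtain ⟨ns, hns, hae⟩ := (tendstoInMeasure_of_tendsto_Lp hlim).exists_seq_tendsto_ae
    have hall : ∀ᵐ x ∂(volume.restrict (Ω : Set (Fin n → ℂ))), ∀ k,
        (F k : Lp ℂ 2 (volume.restrict (Ω : Set (Fin n → ℂ)))) x = bergmanRep (F k) x :=
      ae_all_iff.2 fun k => ae_eq_bergmanRep (F k)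
    filter_upwards [hae, hall, ae_restrict_mem Ω.isOpen.measurableSet] with x h1 h2 h3
    simp only [h2] at h1
    exact tendsto_nhds_unique h1 ((hG x h3).comp hns.tendsto_atTop)

instance completeSpace_bergmanSpace {n : ℕ} (Ω : TopologicalSpace.Opens (Fin n → ℂ)) :
    CompleteSpace (bergmanSpace Ω) :=
  (isClosed_bergmanSpace Ω).completeSpace_coe

/-- `A²(Ω)` is a reproducing kernel Hilbert space: `f ∈ A²(Ω)` is viewed as the function on `Ω`
given by its holomorphic representative, and point evaluations are continuous. -/
noncomputable instance rkhsBergmanSpace {n : ℕ} (Ω : TopologicalSpace.Opens (Fin n → ℂ)) :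
    RKHS ℂ (bergmanSpace Ω) Ω ℂ where
  coeCLM :=
    { toFun := fun f z => bergmanRep f z
      map_add' := fun f₁ f₂ => funext fun z => bergmanRep_add f₁ f₂ z.2
      map_smul' := fun c f => funext fun z => bergmanRep_smul c f z.2
      cont := by
        refine continuous_pi fun z => ?_
        obtain ⟨r, hr, M, hM, hsub, hb⟩ := exists_local_bound Ω.isOpen z.2
        refine LipschitzWith.continuous (K := M.toNNReal) (LipschitzWith.of_dist_le_mul ?_)
        intro f₁ f₂
        rw [dist_eq_norm, dist_eq_norm, Real.coe_toNNReal M hM]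
        have h := (hb _ (differentiableOn_bergmanRep (f₁ - f₂)) _ (ae_eq_bergmanRep (f₁ - f₂)) z
          (Metric.mem_ball_self hr)).1
        rw [bergmanRep_sub f₁ f₂ z.2] at h
        exact h }
  coeCLM_injective := by
    intro f₁ f₂ h
    apply Subtype.ext
    apply Lp.ext
    refine (ae_eq_bergmanRep f₁).trans (EventuallyEq.trans ?_ (ae_eq_bergmanRep f₂).symm)
    filter_upwards [ae_restrict_mem Ω.isOpen.measurableSet] with x hx
    exact congrFun h ⟨x, hx⟩

/-- The Bergman kernel function `K_z ∈ A²(Ω)`, characterised by `⟨f, K_z⟩ = f(z)`, `f ∈ A²(Ω)`. -/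
noncomputable def bergmanKernelFun {n : ℕ} (Ω : TopologicalSpace.Opens (Fin n → ℂ)) (z : Ω) :
    bergmanSpace Ω :=
  RKHS.kerFun (bergmanSpace Ω) z 1

/-- The Bergman kernel `K^Ω(w, z) = K_z(w)`. -/
noncomputable def bergmanKernel {n : ℕ} (Ω : TopologicalSpace.Opens (Fin n → ℂ)) (w z : Ω) : ℂ :=
  bergmanKernelFun Ω z w

/-- The zero set `𝒵 ⊆ Ω` of the Bergman kernel on the diagonal. -/
def bergmanZeroSet {n : ℕ} (Ω : TopologicalSpace.Opens (Fin n → ℂ)) : Set (Fin n → ℂ) :=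
  {z | ∃ h : z ∈ Ω, bergmanKernel Ω ⟨z, h⟩ ⟨z, h⟩ = 0}

/-- The normalized Bergman kernel `k_z = K_z / √K(z, z)`, meaningful for `z ∈ Ω \ 𝒵`. The number
`K(z, z)` is real and nonnegative. -/
noncomputable def normalizedBergmanKernel {n : ℕ} (Ω : TopologicalSpace.Opens (Fin n → ℂ))
    (z : Ω) : bergmanSpace Ω :=
  ((√(bergmanKernel Ω z z).re : ℝ) : ℂ)⁻¹ • bergmanKernelFun Ω z

/-- The Berezin transform `B_Ω T(z) = ⟨T k_z, k_z⟩`, with an inner product that is linear in the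
first slot; Mathlib's inner product is linear in the second slot. -/
noncomputable def berezin {n : ℕ} (Ω : TopologicalSpace.Opens (Fin n → ℂ))
    (T : bergmanSpace Ω →L[ℂ] bergmanSpace Ω) (z : Ω) : ℂ :=
  ⟪normalizedBergmanKernel Ω z, T (normalizedBergmanKernel Ω z)⟫_ℂ

/-! ### Toeplitz operators -/

/-- The space `L^∞(Ω)` of bounded symbols. -/
noncomputable abbrev BoundedSymbol {n : ℕ} (Ω : TopologicalSpace.Opens (Fin n → ℂ)) :=
  Lp ℂ ∞ ((volume : Measure (Fin n → ℂ)).restrict (Ω : Set (Fin n → ℂ)))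

/-- The restriction `φ|_U` of a bounded symbol to a smaller open set. -/
noncomputable def restrictSymbol {n : ℕ} {U Ω : TopologicalSpace.Opens (Fin n → ℂ)}
    (h : U ≤ Ω) (φ : BoundedSymbol Ω) : BoundedSymbol U :=
  ((Lp.memLp φ).mono_measure (Measure.restrict_mono h le_rfl)).toLp φ

/-- The Toeplitz operator `T_φ f = P_Ω (φ f)` on `A²(Ω)`, where `P_Ω : L²(Ω) → A²(Ω)` is the
orthogonal (Bergman) projection. -/
noncomputable def toeplitz {n : ℕ} {Ω : TopologicalSpace.Opens (Fin n → ℂ)}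
    (φ : BoundedSymbol Ω) : bergmanSpace Ω →L[ℂ] bergmanSpace Ω :=
  (bergmanSpace Ω).orthogonalProjectionOnto ∘L
    ((ContinuousLinearMap.mul ℂ ℂ).holderL
      ((volume : Measure (Fin n → ℂ)).restrict (Ω : Set (Fin n → ℂ))) ∞ 2 2 φ) ∘L
    (bergmanSpace Ω).subtypeL

/-- The finite sum of finite products `∑ₘ T_{φ m 0} T_{φ m 1} ⋯ T_{φ m (k m - 1)}`. -/
noncomputable def toeplitzPoly {n : ℕ} {Ω : TopologicalSpace.Opens (Fin n → ℂ)} {l : ℕ}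
    {k : Fin l → ℕ} (φ : (m : Fin l) → Fin (k m) → BoundedSymbol Ω) :
    bergmanSpace Ω →L[ℂ] bergmanSpace Ω :=
  ∑ m, (List.ofFn fun i => toeplitz (φ m i)).prod

open Classical in
/-- The trivial extension `E f` of a function `f` on `Ω` by zero to `ℂⁿ`. -/
noncomputable def extendByZero {n : ℕ} {Ω : TopologicalSpace.Opens (Fin n → ℂ)} (f : Ω → ℂ) :
    (Fin n → ℂ) → ℂ :=
  fun z => if h : z ∈ Ω then f ⟨z, h⟩ else 0

/-! Let `E_j` be extension by zero from `L²(Ω)` to `L²(Ω_j)`, an isometry, and `P_j` the Bergman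
projection of `Ω_j`. On `A²(Ω)` the contraction `P_j E_j` is the adjoint of the restriction map
`A²(Ω_j) → A²(Ω)`, so it sends the kernel function of `Ω` at `z` to that of `Ω_j` at `z`. By
Pythagoras, `‖P_j E_j K_z - E_j K_z‖² = K^Ω(z,z) - K^{Ω_j}(z,z)`, which tends to `0` by assumption.
Kernel functions span a dense subspace and the maps are uniformly bounded, hence `P_j E_j f - E_j f
→ 0` for every `f ∈ A²(Ω)` (`tendsto_norm_projExtend_sub_extendLp`).

Say that `g_j ∈ A²(Ω_j)` tends to `f ∈ A²(Ω)` if `‖g_j - E_j f‖ → 0`. Inner products are continuous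
for this convergence, and Toeplitz operators preserve it: `P_j E_j P_Ω = P_j E_j`, so `T_φ g_j - P_j
E_j T_φ f = P_j (φ (g_j - E_j f))`, which is small, while `P_j E_j T_φ f` is close to `E_j T_φ f`.
Sums and products of Toeplitz operators follow. The kernel functions converge jointly as `j → ∞` and
`z → z₀`, so the quotient `⟨T K_z, K_z⟩ / K(z,z)` does too wherever the limiting denominator is
nonzero. This joint convergence is locally uniform convergence, hence uniform on compact sets.

For `L^p`, the Berezin transforms are bounded by one constant built from the norms of the symbols,
the measure is finite, and dominated convergence applies. -/

section BergmanDomains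

variable {n : ℕ} {U V : TopologicalSpace.Opens (Fin n → ℂ)}

/-! ### Restriction and extension by zero -/

/-- Restriction `L²(V) → L²(U)` for `U ⊆ V`. -/
noncomputable def restrictLp (h : U ≤ V)
    (g : Lp ℂ 2 ((volume : Measure (Fin n → ℂ)).restrict (V : Set (Fin n → ℂ)))) :
    Lp ℂ 2 ((volume : Measure (Fin n → ℂ)).restrict (U : Set (Fin n → ℂ))) :=
  ((Lp.memLp g).mono_measure (Measure.restrict_mono h le_rfl)).toLp g

theorem coeFn_restrictLp (h : U ≤ V)
    (g : Lp ℂ 2 ((volume : Measure (Fin n → ℂ)).restrict (V : Set (Fin n → ℂ)))) :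
    restrictLp h g =ᵐ[volume.restrict (U : Set (Fin n → ℂ))] g :=
  MemLp.coeFn_toLp _

theorem coeFn_restrictSymbol (h : U ≤ V) (φ : BoundedSymbol V) :
    restrictSymbol h φ =ᵐ[volume.restrict (U : Set (Fin n → ℂ))] φ :=
  MemLp.coeFn_toLp _

theorem restrict_restrict_of_le (h : U ≤ V) :
    ((volume : Measure (Fin n → ℂ)).restrict (V : Set (Fin n → ℂ))).restrict
      (U : Set (Fin n → ℂ)) = volume.restrict (U : Set (Fin n → ℂ)) :=
  Measure.restrict_restrict_of_subset h

theorem memLp_indicator_of_le (h : U ≤ V)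
    (f : Lp ℂ 2 ((volume : Measure (Fin n → ℂ)).restrict (U : Set (Fin n → ℂ)))) :
    MemLp ((U : Set (Fin n → ℂ)).indicator f) 2
      (volume.restrict (V : Set (Fin n → ℂ))) := by
  rw [memLp_indicator_iff_restrict U.isOpen.measurableSet, restrict_restrict_of_le h]
  exact Lp.memLp f

theorem indicator_ae_eq_indicator_iff_of_le (h : U ≤ V) {f g : (Fin n → ℂ) → ℂ} :
    (U : Set (Fin n → ℂ)).indicator f =ᵐ[volume.restrict (V : Set (Fin n → ℂ))]
      (U : Set (Fin n → ℂ)).indicator g ↔ f =ᵐ[volume.restrict (U : Set (Fin n → ℂ))] g := by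
  rw [← restrict_restrict_of_le h, EventuallyEq, EventuallyEq,
    ae_restrict_iff' U.isOpen.measurableSet]
  refine eventually_congr (Eventually.of_forall fun x => ?_)
  by_cases hx : x ∈ (U : Set (Fin n → ℂ)) <;> simp [hx]

/-- Extension by zero `L²(U) → L²(V)` for `U ⊆ V`. -/
noncomputable def extendLp (h : U ≤ V) :
    Lp ℂ 2 ((volume : Measure (Fin n → ℂ)).restrict (U : Set (Fin n → ℂ))) →ₗᵢ[ℂ]
    Lp ℂ 2 ((volume : Measure (Fin n → ℂ)).restrict (V : Set (Fin n → ℂ))) where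
  toFun f := (memLp_indicator_of_le h f).toLp _
  map_add' f g := by
    rw [← MemLp.toLp_add, MemLp.toLp_eq_toLp_iff, ← Set.indicator_add',
      indicator_ae_eq_indicator_iff_of_le h]
    exact Lp.coeFn_add f g
  map_smul' c f := by
    rw [RingHom.id_apply, ← MemLp.toLp_const_smul, MemLp.toLp_eq_toLp_iff,
      show c • (U : Set (Fin n → ℂ)).indicator f =
        (U : Set (Fin n → ℂ)).indicator (c • ⇑f) from (Set.indicator_const_smul _ c f).symm,
      indicator_ae_eq_indicator_iff_of_le h]
    exact Lp.coeFn_smul c f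
  norm_map' f := by
    simp only [LinearMap.coe_mk, AddHom.coe_mk]
    rw [Lp.norm_toLp _ (memLp_indicator_of_le h f), Lp.norm_def,
      eLpNorm_indicator_eq_eLpNorm_restrict U.isOpen.measurableSet,
      restrict_restrict_of_le h]

theorem coeFn_extendLp (h : U ≤ V)
    (f : Lp ℂ 2 ((volume : Measure (Fin n → ℂ)).restrict (U : Set (Fin n → ℂ)))) :
    extendLp h f =ᵐ[volume.restrict (V : Set (Fin n → ℂ))] (U : Set (Fin n → ℂ)).indicator f :=
  MemLp.coeFn_toLp (memLp_indicator_of_le h f)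

theorem inner_extendLp (h : U ≤ V)
    (f : Lp ℂ 2 ((volume : Measure (Fin n → ℂ)).restrict (U : Set (Fin n → ℂ))))
    (g : Lp ℂ 2 ((volume : Measure (Fin n → ℂ)).restrict (V : Set (Fin n → ℂ)))) :
    ⟪extendLp h f, g⟫_ℂ = ⟪f, restrictLp h g⟫_ℂ := by
  rw [L2.inner_def, L2.inner_def]
  have h1 : ∫ a in (V : Set (Fin n → ℂ)), ⟪extendLp h f a, g a⟫_ℂ =
      ∫ a in (V : Set (Fin n → ℂ)),
        (U : Set (Fin n → ℂ)).indicator (fun a => ⟪f a, g a⟫_ℂ) a := by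
    refine integral_congr_ae ?_
    filter_upwards [coeFn_extendLp h f] with a ha
    rw [ha]
    by_cases haU : a ∈ (U : Set (Fin n → ℂ)) <;> simp [haU]
  rw [h1, integral_indicator U.isOpen.measurableSet, restrict_restrict_of_le h]
  refine integral_congr_ae ?_
  filter_upwards [coeFn_restrictLp h g] with a ha
  rw [ha]

/-- Restriction `A²(V) → A²(U)` for `U ⊆ V`. -/
noncomputable def restrictBergman (h : U ≤ V) (g : bergmanSpace V) : bergmanSpace U :=
  ⟨restrictLp h g, bergmanRep g, (differentiableOn_bergmanRep g).mono h,
    (coeFn_restrictLp h _).trans (ae_mono (Measure.restrict_mono h le_rfl) (ae_eq_bergmanRep g))⟩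

theorem restrictBergman_apply (h : U ≤ V) (g : bergmanSpace V) (z : U) :
    restrictBergman h g z = g ⟨z, h z.2⟩ :=
  bergmanRep_eq (restrictBergman h g) ((differentiableOn_bergmanRep g).mono h)
    ((coeFn_restrictLp h _).trans
      (ae_mono (Measure.restrict_mono h le_rfl) (ae_eq_bergmanRep g))) z.2

/-- The Bergman projection of the extension by zero, `L²(U) → A²(V)`. -/
noncomputable def projExtend (h : U ≤ V) :
    Lp ℂ 2 ((volume : Measure (Fin n → ℂ)).restrict (U : Set (Fin n → ℂ))) →L[ℂ]
      bergmanSpace V :=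
  (bergmanSpace V).orthogonalProjectionOnto ∘L (extendLp h).toContinuousLinearMap

theorem norm_projExtend_apply_le (h : U ≤ V)
    (f : Lp ℂ 2 ((volume : Measure (Fin n → ℂ)).restrict (U : Set (Fin n → ℂ)))) :
    ‖projExtend h f‖ ≤ ‖f‖ := by
  refine ((bergmanSpace V).norm_orthogonalProjectionOnto_apply_le _).trans ?_
  exact ((extendLp h).norm_map f).le

/-- Adjointness to restriction: both the projection and the extension by zero can be moved to the
other side of the inner product. -/
theorem inner_projExtend (h : U ≤ V)
    (f : Lp ℂ 2 ((volume : Measure (Fin n → ℂ)).restrict (U : Set (Fin n → ℂ))))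
    (g : bergmanSpace V) :
    ⟪projExtend h f, g⟫_ℂ =
      ⟪f, (restrictBergman h g : Lp ℂ 2 (volume.restrict (U : Set (Fin n → ℂ))))⟫_ℂ := by
  refine Eq.trans ?_ (inner_extendLp h f g)
  exact Submodule.inner_orthogonalProjectionOnto_eq_of_mem_right (K := bergmanSpace V) g
    (extendLp h f)

/-- Testing against `g ∈ A²(V)` only sees the restriction of `g` to `U`, which is already in
`A²(U)`, so the inner projection is invisible. -/
theorem projExtend_orthogonalProjectionOnto (h : U ≤ V)
    (f : Lp ℂ 2 ((volume : Measure (Fin n → ℂ)).restrict (U : Set (Fin n → ℂ)))) :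
    projExtend h ((bergmanSpace U).orthogonalProjectionOnto f) = projExtend h f := by
  refine ext_inner_right ℂ fun g => ?_
  rw [inner_projExtend, inner_projExtend]
  exact Submodule.inner_orthogonalProjectionOnto_eq_of_mem_right (restrictBergman h g) f

/-! ### Kernel functions -/

theorem inner_bergmanKernelFun_left (z : U) (f : bergmanSpace U) :
    ⟪bergmanKernelFun U z, f⟫_ℂ = f z := by
  rw [bergmanKernelFun, RKHS.kerFun_inner]
  simp

theorem bergmanKernel_self (z : U) :
    bergmanKernel U z z = ((‖bergmanKernelFun U z‖ ^ 2 : ℝ) : ℂ) := by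
  rw [bergmanKernel, ← inner_bergmanKernelFun_left]
  simp

/-- Evaluation at `z` on `A²(V)` is restriction followed by evaluation on `A²(U)`; taking adjoints
relates the two representing vectors. -/
theorem projExtend_bergmanKernelFun (h : U ≤ V) (z : U) :
    projExtend h (bergmanKernelFun U z) = bergmanKernelFun V ⟨z, h z.2⟩ := by
  refine ext_inner_right ℂ fun g => ?_
  rw [inner_projExtend, ← Submodule.coe_inner, inner_bergmanKernelFun_left,
    inner_bergmanKernelFun_left, restrictBergman_apply]

/-- Pythagoras for the splitting of the extension along `A²(V)` and its complement. Applied to a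
kernel function, the right side is the difference of the two kernels on the diagonal. -/
theorem norm_sq_projExtend_sub_extendLp (h : U ≤ V)
    (f : Lp ℂ 2 ((volume : Measure (Fin n → ℂ)).restrict (U : Set (Fin n → ℂ)))) :
    ‖(projExtend h f : Lp ℂ 2 (volume.restrict (V : Set (Fin n → ℂ)))) - extendLp h f‖ ^ 2 =
      ‖f‖ ^ 2 - ‖projExtend h f‖ ^ 2 := by
  have h1 := Submodule.norm_sq_eq_add_norm_sq_starProjection (extendLp h f) (bergmanSpace V)
  have h2 : (bergmanSpace V)ᗮ.starProjection (extendLp h f) = extendLp h f - projExtend h f := by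
    rw [Submodule.starProjection_orthogonal_val]
    rfl
  rw [h2, (extendLp h).norm_map, norm_sub_rev] at h1
  rw [h1]
  have h3 : ‖(bergmanSpace V).starProjection (extendLp h f)‖ = ‖projExtend h f‖ := rfl
  rw [h3]
  ring

/-- With `f = K_z - K_{z₀}`, the reproducing property gives `‖f‖² = f(z) - f(z₀)`. The local
derivative bound makes this at most `M ‖f‖ ‖z - z₀‖`, and one factor `‖f‖` cancels. -/
theorem continuous_bergmanKernelFun (U : TopologicalSpace.Opens (Fin n → ℂ)) :
    Continuous (bergmanKernelFun U) := by
  refine continuous_iff_continuousAt.2 fun z₀ => ?_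
  obtain ⟨r, hr, M, hM, hsub, hb⟩ := exists_local_bound U.isOpen z₀.2
  rw [ContinuousAt, tendsto_iff_norm_sub_tendsto_zero]
  have hlim : Tendsto (fun z : U => M * ‖(z : Fin n → ℂ) - z₀‖) (𝓝 z₀) (𝓝 0) := by
    have : Continuous fun z : U => M * ‖(z : Fin n → ℂ) - z₀‖ := by fun_prop
    simpa using this.tendsto z₀
  refine squeeze_zero' (Eventually.of_forall fun _ => norm_nonneg _) ?_ hlim
  have hmem : ∀ᶠ z : U in 𝓝 z₀, (z : Fin n → ℂ) ∈ Metric.ball (z₀ : Fin n → ℂ) r :=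
    continuous_subtype_val.continuousAt.eventually (Metric.ball_mem_nhds _ hr)
  filter_upwards [hmem] with z hz
  set f := bergmanKernelFun U z - bergmanKernelFun U z₀ with hf
  have hmv : ‖bergmanRep f z - bergmanRep f z₀‖ ≤ M * ‖f‖ * ‖(z : Fin n → ℂ) - z₀‖ := by
    refine (convex_ball (z₀ : Fin n → ℂ) r).norm_image_sub_le_of_norm_fderiv_le (𝕜 := ℂ) ?_ ?_
      (Metric.mem_ball_self hr) hz
    · exact fun w hw => (differentiableOn_bergmanRep f).differentiableAt
        (U.isOpen.mem_nhds (hsub hw))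
    · exact fun w hw => (hb _ (differentiableOn_bergmanRep f) f (ae_eq_bergmanRep f) w hw).2
  have hsq : ‖f‖ ^ 2 ≤ ‖f‖ * (M * ‖(z : Fin n → ℂ) - z₀‖) := by
    have h1 : ⟪f, f⟫_ℂ = f z - f z₀ := by
      nth_rw 1 [hf]
      rw [inner_sub_left, inner_bergmanKernelFun_left, inner_bergmanKernelFun_left]
    have h2 : ‖f‖ ^ 2 = ‖f z - f z₀‖ := by
      rw [← h1, show ⟪f, f⟫_ℂ = _ from inner_self_eq_norm_sq_to_K (𝕜 := ℂ) f]
      simp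
    rw [h2]
    calc ‖f z - f z₀‖ ≤ M * ‖f‖ * ‖(z : Fin n → ℂ) - z₀‖ := hmv
      _ = _ := by ring
  rcases (norm_nonneg f).eq_or_lt with h0 | h0
  · rw [← h0]; positivity
  · rw [sq] at hsq
    exact le_of_mul_le_mul_left hsq h0

/-- Kernel functions span a dense subspace: a vector orthogonal to all of them vanishes at every
point. -/
theorem bergmanKernelFun_induction {p : bergmanSpace U → Prop}
    (hker : ∀ z, p (bergmanKernelFun U z))
    (hadd : ∀ f g, p f → p g → p (f + g)) (hsmul : ∀ (c : ℂ) f, p f → p (c • f)) (hzero : p 0)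
    (hclosed : IsClosed {f | p f}) (f : bergmanSpace U) : p f := by
  have hspan : ∀ g ∈ Submodule.span ℂ
      {x | ∃ z v, RKHS.kerFun (bergmanSpace U) (𝕜 := ℂ) (X := U) (V := ℂ) z v = x}, p g := by
    intro g hg
    induction hg using Submodule.span_induction with
    | mem x hx =>
      obtain ⟨z, v, rfl⟩ := hx
      have : RKHS.kerFun (bergmanSpace U) (𝕜 := ℂ) (X := U) (V := ℂ) z v =
          v • bergmanKernelFun U z := by
        rw [bergmanKernelFun, ← map_smul, smul_eq_mul, mul_one]
      rw [this]
      exact hsmul _ _ (hker z)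
    | zero => exact hzero
    | add x y _ _ hx hy => exact hadd x y hx hy
    | smul c x _ hx => exact hsmul c x hx
  have hmem : f ∈ (Submodule.span ℂ
      {x | ∃ z v, RKHS.kerFun (bergmanSpace U) (𝕜 := ℂ) (X := U) (V := ℂ) z v = x}
      ).topologicalClosure := by
    rw [RKHS.kerFun_dense]
    trivial
  exact closure_minimal (t := {f | p f}) hspan hclosed hmem

/-! ### Toeplitz operators and restriction -/

theorem toeplitz_apply (φ : BoundedSymbol U) (f : bergmanSpace U) :
    toeplitz φ f = (bergmanSpace U).orthogonalProjectionOnto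
      ((ContinuousLinearMap.mul ℂ ℂ).holder 2 φ
        (f : Lp ℂ 2 (volume.restrict (U : Set (Fin n → ℂ))))) :=
  rfl

theorem norm_holder_mul_le (φ : BoundedSymbol U)
    (f : Lp ℂ 2 ((volume : Measure (Fin n → ℂ)).restrict (U : Set (Fin n → ℂ)))) :
    ‖(ContinuousLinearMap.mul ℂ ℂ).holder 2 φ f‖ ≤ ‖φ‖ * ‖f‖ := by
  refine ((ContinuousLinearMap.mul ℂ ℂ).norm_holder_apply_apply_le φ f).trans ?_
  gcongr
  exact mul_le_of_le_one_left (norm_nonneg _) (ContinuousLinearMap.opNorm_mul_le ℂ ℂ)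

theorem norm_restrictSymbol_le (h : U ≤ V) (φ : BoundedSymbol V) : ‖restrictSymbol h φ‖ ≤ ‖φ‖ := by
  rw [restrictSymbol, Lp.norm_toLp, Lp.norm_def]
  exact ENNReal.toReal_mono (Lp.eLpNorm_ne_top φ)
    (eLpNorm_mono_measure _ (Measure.restrict_mono h le_rfl))

theorem norm_toeplitz_apply_le (φ : BoundedSymbol U) (f : bergmanSpace U) :
    ‖toeplitz φ f‖ ≤ ‖φ‖ * ‖f‖ := by
  rw [toeplitz_apply]
  exact ((bergmanSpace U).norm_orthogonalProjectionOnto_apply_le _).trans (norm_holder_mul_le φ _)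

theorem norm_list_prod_toeplitz_apply_le (h : U ≤ V) (s : List (BoundedSymbol V))
    (f : bergmanSpace U) :
    ‖(s.map fun φ => toeplitz (restrictSymbol h φ)).prod f‖ ≤
      (s.map fun φ => ‖φ‖).prod * ‖f‖ := by
  induction s with
  | nil => simp
  | cons φ s ih =>
    rw [List.map_cons, List.prod_cons, List.map_cons, List.prod_cons,
      mul_apply_eq_comp]
    calc _ ≤ ‖restrictSymbol h φ‖ * _ := norm_toeplitz_apply_le _ _
      _ ≤ ‖φ‖ * ((s.map fun φ => ‖φ‖).prod * ‖f‖) := by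
        gcongr
        exact norm_restrictSymbol_le h φ
      _ = _ := by ring

theorem toeplitzPoly_restrictSymbol (h : U ≤ V) {l : ℕ} {k : Fin l → ℕ}
    (φ : (m : Fin l) → Fin (k m) → BoundedSymbol V) :
    toeplitzPoly (fun m i => restrictSymbol h (φ m i)) =
      ∑ m, ((List.ofFn (φ m)).map fun ψ => toeplitz (restrictSymbol h ψ)).prod := by
  simp only [toeplitzPoly, List.map_ofFn, Function.comp_def]

/-- The bound does not depend on `U`; this supplies the common dominating constant for `Ω` and all
`Ω_j`. -/
theorem norm_toeplitzPoly_le (h : U ≤ V) {l : ℕ} {k : Fin l → ℕ}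
    (φ : (m : Fin l) → Fin (k m) → BoundedSymbol V) :
    ‖toeplitzPoly (fun m i => restrictSymbol h (φ m i))‖ ≤
      ∑ m, ((List.ofFn (φ m)).map fun ψ => ‖ψ‖).prod := by
  rw [toeplitzPoly_restrictSymbol]
  refine norm_sum_le_of_le (E := bergmanSpace U →L[ℂ] bergmanSpace U) _ fun m _ => ?_
  refine ContinuousLinearMap.opNorm_le_bound _ ?_ (norm_list_prod_toeplitz_apply_le h _)
  refine List.prod_nonneg fun a ha => ?_
  obtain ⟨ψ, -, rfl⟩ := List.mem_map.1 ha
  exact norm_nonneg ψ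

theorem extendLp_holder_mul {W : TopologicalSpace.Opens (Fin n → ℂ)} (h : U ≤ V) (hU : U ≤ W)
    (hV : V ≤ W) (φ : BoundedSymbol W)
    (f : Lp ℂ 2 ((volume : Measure (Fin n → ℂ)).restrict (U : Set (Fin n → ℂ)))) :
    extendLp h ((ContinuousLinearMap.mul ℂ ℂ).holder 2 (restrictSymbol hU φ) f) =
      (ContinuousLinearMap.mul ℂ ℂ).holder 2 (restrictSymbol hV φ) (extendLp h f) := by
  apply Lp.ext
  have h1 : (U : Set (Fin n → ℂ)).indicator
      ((ContinuousLinearMap.mul ℂ ℂ).holder (μ := volume.restrict (U : Set (Fin n → ℂ))) 2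
        (restrictSymbol hU φ) f) =ᵐ[volume.restrict (V : Set (Fin n → ℂ))]
      (U : Set (Fin n → ℂ)).indicator fun x => φ x * f x := by
    rw [indicator_ae_eq_indicator_iff_of_le h]
    filter_upwards [(ContinuousLinearMap.mul ℂ ℂ).coeFn_holder (r := 2) (restrictSymbol hU φ) f,
      coeFn_restrictSymbol hU φ] with x hx hx'
    rw [hx, hx']
    rfl
  filter_upwards [coeFn_extendLp h ((ContinuousLinearMap.mul ℂ ℂ).holder 2 (restrictSymbol hU φ) f),
    h1, (ContinuousLinearMap.mul ℂ ℂ).coeFn_holder (r := 2) (restrictSymbol hV φ) (extendLp h f),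
    coeFn_restrictSymbol hV φ, coeFn_extendLp h f] with x e1 e2 e3 e4 e5
  rw [e1, e2, e3, e4, e5]
  by_cases hx : x ∈ (U : Set (Fin n → ℂ)) <;> simp [hx]

/-- The projection inside the Toeplitz operator on `U` is absorbed, and multiplication by a symbol
commutes with extension by zero. -/
theorem projExtend_toeplitz {W : TopologicalSpace.Opens (Fin n → ℂ)} (h : U ≤ V) (hU : U ≤ W)
    (hV : V ≤ W) (φ : BoundedSymbol W) (f : bergmanSpace U) :
    projExtend h (toeplitz (restrictSymbol hU φ) f) =
      (bergmanSpace V).orthogonalProjectionOnto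
        ((ContinuousLinearMap.mul ℂ ℂ).holder 2 (restrictSymbol hV φ) (extendLp h f)) := by
  rw [toeplitz_apply, projExtend_orthogonalProjectionOnto, ← extendLp_holder_mul h hU]
  rfl

theorem holder_mul_sub (φ : BoundedSymbol U)
    (f g : Lp ℂ 2 ((volume : Measure (Fin n → ℂ)).restrict (U : Set (Fin n → ℂ)))) :
    (ContinuousLinearMap.mul ℂ ℂ).holder 2 φ (f - g) =
      (ContinuousLinearMap.mul ℂ ℂ).holder 2 φ f - (ContinuousLinearMap.mul ℂ ℂ).holder 2 φ g :=
  map_sub ((ContinuousLinearMap.mul ℂ ℂ).holderL _ ∞ 2 2 φ) f g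

theorem norm_toeplitz_sub_projExtend_le {W : TopologicalSpace.Opens (Fin n → ℂ)} (h : U ≤ V)
    (hU : U ≤ W) (hV : V ≤ W) (φ : BoundedSymbol W) (g : bergmanSpace V) (f : bergmanSpace U) :
    ‖(toeplitz (restrictSymbol hV φ) g : Lp ℂ 2 (volume.restrict (V : Set (Fin n → ℂ)))) -
        projExtend h (toeplitz (restrictSymbol hU φ) f)‖ ≤
      ‖φ‖ * ‖(g : Lp ℂ 2 (volume.restrict (V : Set (Fin n → ℂ)))) - extendLp h f‖ := by
  rw [projExtend_toeplitz h hU hV, toeplitz_apply, ← Submodule.coe_sub, ← map_sub,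
    ← holder_mul_sub]
  refine ((bergmanSpace V).norm_orthogonalProjectionOnto_apply_le _).trans ?_
  refine (norm_holder_mul_le _ _).trans ?_
  gcongr
  exact norm_restrictSymbol_le hV φ

/-! ### Convergence of elements of varying Bergman spaces -/

section Convergence

variable {Ω : TopologicalSpace.Opens (Fin n → ℂ)} {D : ℕ → TopologicalSpace.Opens (Fin n → ℂ)}
  {hΩD : ∀ j, Ω ≤ D j} {ι : Type*} {L : Filter ι} {J : ι → ℕ}

/-- The only place where the convergence of the kernels on the diagonal is used directly: it settles
kernel functions, and density together with uniform boundedness does the rest. -/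
theorem tendsto_norm_projExtend_sub_extendLp
    (hK : ∀ z : Ω, Tendsto
      (fun j => bergmanKernel (D j) ⟨z, hΩD j z.2⟩ ⟨z, hΩD j z.2⟩) atTop
      (𝓝 (bergmanKernel Ω z z))) (f : bergmanSpace Ω) :
    Tendsto (fun j => ‖(projExtend (hΩD j) f :
      Lp ℂ 2 (volume.restrict (D j : Set (Fin n → ℂ)))) - extendLp (hΩD j) f‖) atTop (𝓝 0) := by
  induction f using bergmanKernelFun_induction with
  | hker z =>
    have hsq : Tendsto (fun j => ‖bergmanKernelFun Ω z‖ ^ 2 -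
        ‖bergmanKernelFun (D j) ⟨z, hΩD j z.2⟩‖ ^ 2) atTop (𝓝 0) := by
      have h := (Complex.continuous_re.tendsto _).comp (hK z)
      simp only [Function.comp_def, bergmanKernel_self, Complex.ofReal_re] at h
      rw [← sub_self (‖bergmanKernelFun Ω z‖ ^ 2)]
      exact h.const_sub _
    have h := (Real.continuous_sqrt.tendsto 0).comp hsq
    rw [Real.sqrt_zero] at h
    refine h.congr fun j => ?_
    rw [Function.comp_apply, ← projExtend_bergmanKernelFun (hΩD j)]
    rw [← Real.sqrt_sq (norm_nonneg ((projExtend (hΩD j) (bergmanKernelFun Ω z) :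
      Lp ℂ 2 (volume.restrict (D j : Set (Fin n → ℂ)))) -
      extendLp (hΩD j) (bergmanKernelFun Ω z))), norm_sq_projExtend_sub_extendLp]
    rfl
  | hadd f g hf hg =>
    refine squeeze_zero (fun _ => norm_nonneg _) (fun j => ?_) (by simpa using hf.add hg)
    rw [Submodule.coe_add, map_add, map_add, Submodule.coe_add, add_sub_add_comm]
    exact norm_add_le _ _
  | hsmul c f hf =>
    have h := hf.const_mul ‖c‖
    rw [mul_zero] at h
    refine h.congr fun j => ?_
    rw [Submodule.coe_smul, map_smul, map_smul, Submodule.coe_smul, ← smul_sub, norm_smul]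
  | hzero => simp
  | hclosed =>
    refine isClosed_of_closure_subset fun f hf => ?_
    refine Metric.tendsto_atTop.2 fun ε hε => ?_
    -- The projected and the plain extension of `f - g` each cost at most `‖f - g‖ < ε / 3`; the
    -- last third is for `g` itself.
    obtain ⟨g, hg, hfg⟩ := Metric.mem_closure_iff.1 hf (ε / 3) (by positivity)
    obtain ⟨N, hN⟩ := Metric.tendsto_atTop.1 hg (ε / 3) (by positivity)
    refine ⟨N, fun j hj => ?_⟩
    have h1 := hN j hj
    rw [dist_zero_right, norm_norm] at h1 ⊢
    have h2 : ‖(projExtend (hΩD j) (f - g : bergmanSpace Ω) :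
        Lp ℂ 2 (volume.restrict (D j : Set (Fin n → ℂ))))‖ ≤ ‖f - g‖ :=
      norm_projExtend_apply_le _ _
    have h3 : ‖extendLp (hΩD j) (f - g : bergmanSpace Ω)‖ = ‖f - g‖ :=
      (extendLp (hΩD j)).norm_map _
    rw [dist_eq_norm] at hfg
    have h4 : (projExtend (hΩD j) f : Lp ℂ 2 (volume.restrict (D j : Set (Fin n → ℂ)))) -
        extendLp (hΩD j) f =
        ((projExtend (hΩD j) (f - g : bergmanSpace Ω) :
          Lp ℂ 2 (volume.restrict (D j : Set (Fin n → ℂ)))) -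
        extendLp (hΩD j) (f - g : bergmanSpace Ω)) +
        ((projExtend (hΩD j) g : Lp ℂ 2 (volume.restrict (D j : Set (Fin n → ℂ)))) -
        extendLp (hΩD j) g) := by
      rw [Submodule.coe_sub, map_sub, map_sub, Submodule.coe_sub]
      abel
    rw [h4]
    refine (norm_add_le _ _).trans_lt ?_
    have h5 := norm_sub_le (projExtend (hΩD j) (f - g : bergmanSpace Ω) :
      Lp ℂ 2 (volume.restrict (D j : Set (Fin n → ℂ))))
      (extendLp (hΩD j) (f - g : bergmanSpace Ω))
    linarith

/-- Elements `g i ∈ A²(D (J i))` converge to `f ∈ A²(Ω)`, in the sense that their `L²` distance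
to the extension of `f` by zero tends to `0`. -/
def BergmanTendsto (hΩD : ∀ j, Ω ≤ D j) (L : Filter ι) (J : ι → ℕ)
    (g : (i : ι) → bergmanSpace (D (J i))) (f : bergmanSpace Ω) : Prop :=
  Tendsto (fun i => ‖(g i : Lp ℂ 2 (volume.restrict (D (J i) : Set (Fin n → ℂ)))) -
    extendLp (hΩD (J i)) f‖) L (𝓝 0)

theorem BergmanTendsto.zero : BergmanTendsto hΩD L J (fun _ => 0) 0 := by
  simpa [BergmanTendsto] using tendsto_const_nhds

theorem BergmanTendsto.add {g g' : (i : ι) → bergmanSpace (D (J i))} {f f' : bergmanSpace Ω}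
    (h : BergmanTendsto hΩD L J g f) (h' : BergmanTendsto hΩD L J g' f') :
    BergmanTendsto hΩD L J (fun i => g i + g' i) (f + f') := by
  refine squeeze_zero (fun _ => norm_nonneg _) (fun i => ?_) (by simpa using Tendsto.add h h')
  rw [Submodule.coe_add, Submodule.coe_add, map_add, add_sub_add_comm]
  exact norm_add_le _ _

theorem BergmanTendsto.sum {α : Type*} (s : Finset α)
    {g : α → (i : ι) → bergmanSpace (D (J i))} {f : α → bergmanSpace Ω}
    (h : ∀ a ∈ s, BergmanTendsto hΩD L J (g a) (f a)) :
    BergmanTendsto hΩD L J (fun i => ∑ a ∈ s, g a i) (∑ a ∈ s, f a) := by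
  classical
  induction s using Finset.induction_on with
  | empty => simpa using BergmanTendsto.zero
  | insert a s ha ih =>
    simp only [Finset.sum_insert ha]
    exact (h a (Finset.mem_insert_self a s)).add
      (ih fun b hb => h b (Finset.mem_insert_of_mem hb))

theorem BergmanTendsto.inner {g g' : (i : ι) → bergmanSpace (D (J i))} {f f' : bergmanSpace Ω}
    (h : BergmanTendsto hΩD L J g f) (h' : BergmanTendsto hΩD L J g' f') :
    Tendsto (fun i => ⟪g i, g' i⟫_ℂ) L (𝓝 ⟪f, f'⟫_ℂ) := by
  rw [tendsto_iff_norm_sub_tendsto_zero]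
  -- The factor `‖g' i - E f'‖ + ‖f'‖` bounds `‖g' i‖`, for which no separate bound is assumed.
  have hlim := (Tendsto.mul h (Tendsto.add_const ‖f'‖ h')).add (Tendsto.const_mul ‖f‖ h')
  rw [zero_mul, mul_zero, zero_add] at hlim
  refine squeeze_zero (fun _ => norm_nonneg _) (fun i => ?_) hlim
  set E := extendLp (hΩD (J i))
  have hE : ⟪f, f'⟫_ℂ = ⟪E f, E f'⟫_ℂ := (E.inner_map_map _ _).symm
  have hg : ⟪g i, g' i⟫_ℂ = ⟪(g i : Lp ℂ 2 (volume.restrict (D (J i) : Set (Fin n → ℂ)))),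
    (g' i : Lp ℂ 2 (volume.restrict (D (J i) : Set (Fin n → ℂ))))⟫_ℂ := rfl
  have hEf : ‖E f‖ = ‖f‖ := E.norm_map _
  have hEf' : ‖E f'‖ = ‖f'‖ := E.norm_map _
  rw [hE, hg, ← hEf, ← hEf']
  generalize (g i : Lp ℂ 2 (volume.restrict (D (J i) : Set (Fin n → ℂ)))) = a
  generalize (g' i : Lp ℂ 2 (volume.restrict (D (J i) : Set (Fin n → ℂ)))) = a'
  have hsplit : ⟪a, a'⟫_ℂ - ⟪E f, E f'⟫_ℂ = ⟪a - E f, a'⟫_ℂ + ⟪E f, a' - E f'⟫_ℂ := by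
    rw [inner_sub_left, inner_sub_right]
    ring
  rw [hsplit]
  refine (norm_add_le _ _).trans (add_le_add ?_ (norm_inner_le_norm _ _))
  refine (norm_inner_le_norm _ _).trans ?_
  gcongr
  simpa using norm_add_le (a' - E f') (E f')

/-- The comparison vector is the projected extension of `T_φ f`. Its distance to `T_φ (g i)` is
controlled by `‖φ‖` and the convergence of `g`; its distance to the plain extension tends to `0`
because `T_φ f` is a fixed element of `A²(Ω)`. -/
theorem bergmanTendsto_toeplitz
    (hK : ∀ z : Ω, Tendsto
      (fun j => bergmanKernel (D j) ⟨z, hΩD j z.2⟩ ⟨z, hΩD j z.2⟩) atTop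
      (𝓝 (bergmanKernel Ω z z)))
    (hJ : Tendsto J L atTop) (hD : ∀ j, D j ≤ V) (hΩV : Ω ≤ V) (φ : BoundedSymbol V)
    {g : (i : ι) → bergmanSpace (D (J i))} {f : bergmanSpace Ω}
    (h : BergmanTendsto hΩD L J g f) :
    BergmanTendsto hΩD L J (fun i => toeplitz (restrictSymbol (hD (J i)) φ) (g i))
      (toeplitz (restrictSymbol hΩV φ) f) := by
  have hlim := (Tendsto.const_mul ‖φ‖ h).add
    ((tendsto_norm_projExtend_sub_extendLp hK (toeplitz (restrictSymbol hΩV φ) f)).comp hJ)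
  rw [mul_zero, zero_add] at hlim
  refine squeeze_zero (fun _ => norm_nonneg _) (fun i => ?_) hlim
  rw [Function.comp_apply]
  refine (norm_sub_le_norm_sub_add_norm_sub _
    (projExtend (hΩD (J i)) (toeplitz (restrictSymbol hΩV φ) f) :
      Lp ℂ 2 (volume.restrict (D (J i) : Set (Fin n → ℂ)))) _).trans ?_
  gcongr
  exact norm_toeplitz_sub_projExtend_le (hΩD (J i)) hΩV (hD (J i)) φ (g i) f

theorem bergmanTendsto_toeplitzPoly
    (hK : ∀ z : Ω, Tendsto
      (fun j => bergmanKernel (D j) ⟨z, hΩD j z.2⟩ ⟨z, hΩD j z.2⟩) atTop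
      (𝓝 (bergmanKernel Ω z z)))
    (hJ : Tendsto J L atTop) (hD : ∀ j, D j ≤ V) (hΩV : Ω ≤ V) {l : ℕ} {k : Fin l → ℕ}
    (φ : (m : Fin l) → Fin (k m) → BoundedSymbol V)
    {g : (i : ι) → bergmanSpace (D (J i))} {f : bergmanSpace Ω}
    (h : BergmanTendsto hΩD L J g f) :
    BergmanTendsto hΩD L J
      (fun i => toeplitzPoly (fun m i' => restrictSymbol (hD (J i)) (φ m i')) (g i))
      (toeplitzPoly (fun m i' => restrictSymbol hΩV (φ m i')) f) := by
  simp only [toeplitzPoly_restrictSymbol, _root_.sum_apply]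
  refine BergmanTendsto.sum _ fun m _ => ?_
  induction List.ofFn (φ m) with
  | nil => simpa using h
  | cons ψ s ih =>
    simp only [List.map_cons, List.prod_cons, mul_apply_eq_comp]
    exact bergmanTendsto_toeplitz hK hJ hD hΩV ψ ih

/-- The index `i` carries both a domain and a point, so `L = atTop ×ˢ 𝓝 z₀` gives joint convergence
in `j` and `z`. Moving the point costs at most `‖K_{z i} - K_{z₀}‖` in `A²(Ω)`, uniformly over the
domains, because the projected extension is a contraction. -/
theorem bergmanTendsto_bergmanKernelFun
    (hK : ∀ z : Ω, Tendsto
      (fun j => bergmanKernel (D j) ⟨z, hΩD j z.2⟩ ⟨z, hΩD j z.2⟩) atTop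
      (𝓝 (bergmanKernel Ω z z)))
    (hJ : Tendsto J L atTop) {z : ι → Ω} {z₀ : Ω} (hz : Tendsto z L (𝓝 z₀)) :
    BergmanTendsto hΩD L J (fun i => bergmanKernelFun (D (J i)) ⟨z i, hΩD (J i) (z i).2⟩)
      (bergmanKernelFun Ω z₀) := by
  have h1 := tendsto_iff_norm_sub_tendsto_zero.1
    (((continuous_bergmanKernelFun Ω).tendsto z₀).comp hz)
  have hlim := h1.add ((tendsto_norm_projExtend_sub_extendLp hK (bergmanKernelFun Ω z₀)).comp hJ)
  rw [zero_add] at hlim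
  refine squeeze_zero (fun _ => norm_nonneg _) (fun i => ?_) hlim
  simp only [Function.comp_apply]
  rw [← projExtend_bergmanKernelFun (hΩD (J i))]
  refine (norm_sub_le_norm_sub_add_norm_sub _ (projExtend (hΩD (J i)) (bergmanKernelFun Ω z₀) :
    Lp ℂ 2 (volume.restrict (D (J i) : Set (Fin n → ℂ)))) _).trans ?_
  gcongr
  rw [← Submodule.coe_sub, ← map_sub]
  exact norm_projExtend_apply_le _ _

end Convergence

/-! ### The Berezin transform -/

theorem bergmanKernel_self_eq_inner (z : U) :
    bergmanKernel U z z = ⟪bergmanKernelFun U z, bergmanKernelFun U z⟫_ℂ :=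
  (inner_bergmanKernelFun_left z _).symm

theorem mem_bergmanZeroSet_iff (z : U) :
    (z : Fin n → ℂ) ∈ bergmanZeroSet U ↔ bergmanKernelFun U z = 0 := by
  have h : (z : Fin n → ℂ) ∈ bergmanZeroSet U ↔ bergmanKernel U z z = 0 :=
    ⟨fun ⟨_, h⟩ => h, fun h => ⟨z.2, h⟩⟩
  rw [h, bergmanKernel_self_eq_inner]
  exact inner_self_eq_zero (𝕜 := ℂ) (E := bergmanSpace U)

/-- The kernel function of the larger set is a linear image of that of the smaller one, so it
vanishes along with it. -/
theorem bergmanZeroSet_mono (h : U ≤ V) {z : Fin n → ℂ} (hz : z ∈ bergmanZeroSet U) :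
    z ∈ bergmanZeroSet V := by
  obtain ⟨hzU, -⟩ := id hz
  have h1 := (mem_bergmanZeroSet_iff ⟨z, hzU⟩).1 hz
  refine (mem_bergmanZeroSet_iff (U := V) ⟨z, h hzU⟩).2 ?_
  rw [← projExtend_bergmanKernelFun h ⟨z, hzU⟩, h1]
  exact map_zero _

theorem normalizedBergmanKernel_eq (z : U) :
    normalizedBergmanKernel U z = ((‖bergmanKernelFun U z‖ : ℝ) : ℂ)⁻¹ • bergmanKernelFun U z := by
  rw [normalizedBergmanKernel, bergmanKernel_self, Complex.ofReal_re,
    Real.sqrt_sq (norm_nonneg _)]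

/-- An inequality, because on the zero set the convention `0⁻¹ = 0` makes the normalized kernel `0`.
-/
theorem norm_normalizedBergmanKernel_le (z : U) : ‖normalizedBergmanKernel U z‖ ≤ 1 := by
  rw [normalizedBergmanKernel_eq, norm_smul, norm_inv, Complex.norm_real, norm_norm]
  exact inv_mul_le_one

theorem norm_berezin_le (T : bergmanSpace U →L[ℂ] bergmanSpace U) (z : U) :
    ‖berezin U T z‖ ≤ ‖T‖ := by
  have h := norm_normalizedBergmanKernel_le z
  calc ‖berezin U T z‖ ≤ ‖normalizedBergmanKernel U z‖ * ‖T (normalizedBergmanKernel U z)‖ :=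
        norm_inner_le_norm (𝕜 := ℂ) (E := bergmanSpace U) _ _
    _ ≤ 1 * (‖T‖ * 1) := by
        gcongr
        exact T.le_opNorm_of_le h
    _ = ‖T‖ := by ring

/-- Holds on the zero set too, where both sides are `0` by the conventions for inverses. Continuity
off the zero set and measurability everywhere are read off from this quotient of continuous
functions. -/
theorem berezin_eq_div (T : bergmanSpace U →L[ℂ] bergmanSpace U) (z : U) :
    berezin U T z = ⟪bergmanKernelFun U z, T (bergmanKernelFun U z)⟫_ℂ / bergmanKernel U z z := by
  rw [berezin, normalizedBergmanKernel_eq, map_smul, bergmanKernel_self, Complex.ofReal_pow]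
  refine (inner_smul_left (𝕜 := ℂ) (E := bergmanSpace U) _ _ _).trans ?_
  refine (congrArg _ (inner_smul_right (𝕜 := ℂ) (E := bergmanSpace U) _ _ _)).trans ?_
  rw [map_inv₀, Complex.conj_ofReal]
  ring

theorem berezin_eq_zero_of_mem_bergmanZeroSet (T : bergmanSpace U →L[ℂ] bergmanSpace U) {z : U}
    (hz : (z : Fin n → ℂ) ∈ bergmanZeroSet U) : berezin U T z = 0 := by
  rw [berezin_eq_div, (mem_bergmanZeroSet_iff z).1 hz, inner_zero_left, zero_div]

theorem extendByZero_of_mem (f : U → ℂ) {z : Fin n → ℂ} (hz : z ∈ U) :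
    extendByZero f z = f ⟨z, hz⟩ :=
  dif_pos hz

theorem continuous_inner_bergmanKernelFun (T : bergmanSpace U →L[ℂ] bergmanSpace U) :
    Continuous fun z => ⟪bergmanKernelFun U z, T (bergmanKernelFun U z)⟫_ℂ :=
  (continuous_bergmanKernelFun U).inner (T.continuous.comp (continuous_bergmanKernelFun U))

theorem continuous_bergmanKernel_self (U : TopologicalSpace.Opens (Fin n → ℂ)) :
    Continuous fun z => bergmanKernel U z z := by
  simp only [bergmanKernel_self_eq_inner]
  exact (continuous_bergmanKernelFun U).inner (continuous_bergmanKernelFun U)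

theorem continuousAt_berezin (T : bergmanSpace U →L[ℂ] bergmanSpace U) {z : U}
    (hz : (z : Fin n → ℂ) ∉ bergmanZeroSet U) : ContinuousAt (berezin U T) z := by
  rw [funext (berezin_eq_div T)]
  exact (continuous_inner_bergmanKernelFun T).continuousAt.div
    (continuous_bergmanKernel_self U).continuousAt fun h => hz ⟨z.2, h⟩

theorem measurable_extendByZero {f : U → ℂ} (hf : Measurable f) : Measurable (extendByZero f) := by
  refine measurable_of_restrict_of_restrict_compl U.isOpen.measurableSet ?_ ?_
  · have h : (U : Set (Fin n → ℂ)).domRestrict (extendByZero f) = f :=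
      funext fun z => extendByZero_of_mem f z.2
    rw [h]
    exact hf
  · have h : (U : Set (Fin n → ℂ))ᶜ.domRestrict (extendByZero f) = fun _ => 0 :=
      funext fun z => dif_neg z.2
    rw [h]
    exact measurable_const

theorem measurable_extendByZero_berezin (T : bergmanSpace U →L[ℂ] bergmanSpace U) :
    Measurable (extendByZero (berezin U T)) := by
  refine measurable_extendByZero ?_
  rw [funext (berezin_eq_div T)]
  exact (continuous_inner_bergmanKernelFun T).measurable.div
    (continuous_bergmanKernel_self U).measurable

theorem norm_extendByZero_berezin_le {T : bergmanSpace U →L[ℂ] bergmanSpace U} {C : ℝ}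
    (hT : ‖T‖ ≤ C) (z : Fin n → ℂ) : ‖extendByZero (berezin U T) z‖ ≤ C := by
  by_cases hz : z ∈ U
  · rw [extendByZero_of_mem _ hz]
    exact (norm_berezin_le T _).trans hT
  · rw [extendByZero, dif_neg hz, norm_zero]
    exact (norm_nonneg T).trans hT

/-- Bounded convergence in `L^p`, `0 < p < ∞`. -/
theorem tendsto_eLpNorm_sub_of_bounded {α : Type*} [MeasurableSpace α] {μ : Measure α}
    [IsFiniteMeasure μ] {F : ℕ → α → ℂ} {f : α → ℂ} {C : ℝ} (hF : ∀ j, Measurable (F j))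
    (hf : Measurable f) (hFC : ∀ j x, ‖F j x‖ ≤ C) (hfC : ∀ x, ‖f x‖ ≤ C)
    (hlim : ∀ᵐ x ∂μ, Tendsto (fun j => F j x) atTop (𝓝 (f x))) {p : ℝ} (hp : 0 < p) :
    Tendsto (fun j => eLpNorm (fun x => F j x - f x) (ENNReal.ofReal p) μ) atTop (𝓝 0) := by
  have hp0 : ENNReal.ofReal p ≠ 0 := by simpa using hp
  -- Working with the integral of the `p`-th power avoids the triangle inequality in `L^p`, so `p <
  -- 1` needs no separate treatment.
  simp only [eLpNorm_eq_lintegral_rpow_enorm_toReal hp0 ENNReal.ofReal_ne_top,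
    ENNReal.toReal_ofReal hp.le]
  have hint : Tendsto (fun j => ∫⁻ x, ‖F j x - f x‖ₑ ^ p ∂μ) atTop (𝓝 0) := by
    have h := tendsto_lintegral_of_dominated_convergence (μ := μ)
      (F := fun j x => ‖F j x - f x‖ₑ ^ p) (f := fun _ => 0)
      (fun _ => ENNReal.ofReal (C + C) ^ p)
      (fun j => ((hF j).sub hf).enorm.pow_const p)
      (fun j => Eventually.of_forall fun x => ?_) ?_ ?_
    · simpa using h
    · refine ENNReal.rpow_le_rpow ?_ hp.le
      rw [← ofReal_norm]
      exact ENNReal.ofReal_le_ofReal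
        ((norm_sub_le _ _).trans (add_le_add (hFC j x) (hfC x)))
    · rw [lintegral_const]
      finiteness
    · filter_upwards [hlim] with x hx
      have h1 : Tendsto (fun j => ‖F j x - f x‖ₑ) atTop (𝓝 0) := by
        simpa using (hx.sub_const (f x)).enorm
      simpa [ENNReal.zero_rpow_of_pos hp, Function.comp_def] using
        (ENNReal.continuous_rpow_const (y := p)).tendsto 0 |>.comp h1
  simpa [ENNReal.zero_rpow_of_pos (inv_pos.2 hp), Function.comp_def] using
    (ENNReal.continuous_rpow_const (y := 1 / p)).tendsto 0 |>.comp hint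

/-! ### Convergence of Berezin transforms -/

section Convergence

variable {Ω : TopologicalSpace.Opens (Fin n → ℂ)} {D : ℕ → TopologicalSpace.Opens (Fin n → ℂ)}
  {hΩD : ∀ j, Ω ≤ D j} {ι : Type*} {L : Filter ι} {J : ι → ℕ}

theorem tendsto_bergmanKernel_self
    (hK : ∀ z : Ω, Tendsto
      (fun j => bergmanKernel (D j) ⟨z, hΩD j z.2⟩ ⟨z, hΩD j z.2⟩) atTop
      (𝓝 (bergmanKernel Ω z z)))
    (hJ : Tendsto J L atTop) {z : ι → Ω} {z₀ : Ω} (hz : Tendsto z L (𝓝 z₀)) :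
    Tendsto (fun i => bergmanKernel (D (J i)) ⟨z i, hΩD (J i) (z i).2⟩ ⟨z i, hΩD (J i) (z i).2⟩) L
      (𝓝 (bergmanKernel Ω z₀ z₀)) := by
  simp only [bergmanKernel_self_eq_inner]
  have h := bergmanTendsto_bergmanKernelFun hK hJ hz
  exact h.inner h

theorem tendsto_berezin_toeplitzPoly
    (hK : ∀ z : Ω, Tendsto
      (fun j => bergmanKernel (D j) ⟨z, hΩD j z.2⟩ ⟨z, hΩD j z.2⟩) atTop
      (𝓝 (bergmanKernel Ω z z)))
    (hJ : Tendsto J L atTop) (hD : ∀ j, D j ≤ V) (hΩV : Ω ≤ V) {l : ℕ} {k : Fin l → ℕ}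
    (φ : (m : Fin l) → Fin (k m) → BoundedSymbol V)
    {z : ι → Ω} {z₀ : Ω} (hz : Tendsto z L (𝓝 z₀))
    (hz₀ : (z₀ : Fin n → ℂ) ∉ bergmanZeroSet Ω) :
    Tendsto (fun i => berezin (D (J i))
        (toeplitzPoly fun m i' => restrictSymbol (hD (J i)) (φ m i')) ⟨z i, hΩD (J i) (z i).2⟩) L
      (𝓝 (berezin Ω (toeplitzPoly fun m i' => restrictSymbol hΩV (φ m i')) z₀)) := by
  simp only [berezin_eq_div]
  have h := bergmanTendsto_bergmanKernelFun hK hJ hz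
  exact (h.inner (bergmanTendsto_toeplitzPoly hK hJ hD hΩV φ h)).div
    (tendsto_bergmanKernel_self hK hJ hz) fun h0 => hz₀ ⟨z₀.2, h0⟩

/-- Joint convergence of the diagonal kernels to a nonzero limit gives, near each point of `K`, a
neighbourhood free of zeros for all large `j`; compactness makes the choice of `j` uniform. -/
theorem eventually_disjoint_bergmanZeroSet
    (hK : ∀ z : Ω, Tendsto
      (fun j => bergmanKernel (D j) ⟨z, hΩD j z.2⟩ ⟨z, hΩD j z.2⟩) atTop
      (𝓝 (bergmanKernel Ω z z)))
    {K : Set (Fin n → ℂ)} (hKc : IsCompact K)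
    (hKΩ : K ⊆ (Ω : Set (Fin n → ℂ)) \ bergmanZeroSet Ω) :
    ∀ᶠ j in atTop, Disjoint K (bergmanZeroSet (D j)) := by
  refine hKc.induction_on (p := fun S => ∀ᶠ j in atTop, Disjoint S (bergmanZeroSet (D j)))
    (by simp) (fun s t hst h => h.mono fun j hj => hj.mono_left hst)
    (fun s t hs ht => by filter_upwards [hs, ht] with j h1 h2 using h1.union_left h2)
    fun x hx => ?_
  obtain ⟨hxΩ, hxZ⟩ := hKΩ hx
  have h := (tendsto_bergmanKernel_self hK (L := atTop ×ˢ 𝓝 (⟨x, hxΩ⟩ : Ω))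
    tendsto_fst tendsto_snd).eventually_ne (b₂ := 0)
    fun h0 => hxZ ⟨hxΩ, h0⟩
  -- `P` holds for all large `j` and `Q` on a neighbourhood of `x` in `Ω`, independently of each
  -- other.
  obtain ⟨P, hP, Q, hQ, hPQ⟩ := eventually_prod_iff.1 h
  refine ⟨Subtype.val '' {z : Ω | Q z}, mem_nhdsWithin_of_mem_nhds
    (Ω.isOpen.isOpenEmbedding_subtypeVal.image_mem_nhds.2 hQ), ?_⟩
  filter_upwards [hP] with j hj
  rw [Set.disjoint_left]
  rintro _ ⟨z, hz, rfl⟩ ⟨_, h0⟩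
  exact hPQ hj hz h0

theorem tendstoUniformlyOn_berezin_toeplitzPoly
    (hK : ∀ z : Ω, Tendsto
      (fun j => bergmanKernel (D j) ⟨z, hΩD j z.2⟩ ⟨z, hΩD j z.2⟩) atTop
      (𝓝 (bergmanKernel Ω z z)))
    (hD : ∀ j, D j ≤ V) (hΩV : Ω ≤ V) {l : ℕ} {k : Fin l → ℕ}
    (φ : (m : Fin l) → Fin (k m) → BoundedSymbol V)
    {K : Set (Fin n → ℂ)} (hKc : IsCompact K)
    (hKΩ : K ⊆ (Ω : Set (Fin n → ℂ)) \ bergmanZeroSet Ω) :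
    TendstoUniformlyOn
      (fun j => extendByZero (berezin (D j)
        (toeplitzPoly fun m i => restrictSymbol (hD j) (φ m i))))
      (extendByZero (berezin Ω (toeplitzPoly fun m i => restrictSymbol hΩV (φ m i))))
      atTop K := by
  rw [← tendstoLocallyUniformlyOn_iff_tendstoUniformlyOn_of_compact hKc,
    tendstoLocallyUniformlyOn_iff_forall_tendsto]
  intro x hx
  obtain ⟨hxΩ, hxZ⟩ := hKΩ hx
  -- Points of `K` near `x` lie in `Ω`, so the limit can be taken along the subtype, where the joint
  -- convergence is available.
  have hle : 𝓝[K] x ≤ map Subtype.val (𝓝 (⟨x, hxΩ⟩ : Ω)) := by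
    rw [map_nhds_subtype_val]
    exact nhdsWithin_mono x fun y hy => (hKΩ hy).1
  refine Tendsto.mono_left ?_ (Filter.prod_mono le_rfl hle)
  rw [prod_map_right, tendsto_map'_iff]
  have h1 := tendsto_berezin_toeplitzPoly hK (L := atTop ×ˢ 𝓝 (⟨x, hxΩ⟩ : Ω))
    tendsto_fst hD hΩV φ tendsto_snd hxZ
  -- The limit transform is continuous at `x`, so both entries of the pair to be compared tend to
  -- its value there. Neighbourhoods of a diagonal point refine the uniformity.
  have h2 := (continuousAt_berezin (toeplitzPoly fun m i => restrictSymbol hΩV (φ m i))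
    (z := ⟨x, hxΩ⟩) hxZ).tendsto.comp (tendsto_snd (f := (atTop : Filter ℕ)))
  have h3 := h2.prodMk_nhds h1
  refine (h3.mono_right (nhds_le_uniformity _)).congr fun y => ?_
  simp only [Function.comp_apply, Prod.map_fst, Prod.map_snd, id_eq]
  rw [extendByZero_of_mem _ y.2.2, extendByZero_of_mem _ (hΩD y.1 y.2.2)]

/-- Convergence at every point of `Ω`: on the zero set all the transforms take the default value
`0`, so that set need not be shown to be null. -/
theorem tendsto_extendByZero_berezin_toeplitzPoly
    (hK : ∀ z : Ω, Tendsto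
      (fun j => bergmanKernel (D j) ⟨z, hΩD j z.2⟩ ⟨z, hΩD j z.2⟩) atTop
      (𝓝 (bergmanKernel Ω z z)))
    (hD : ∀ j, D j ≤ V) (hΩV : Ω ≤ V) {l : ℕ} {k : Fin l → ℕ}
    (φ : (m : Fin l) → Fin (k m) → BoundedSymbol V) {z : Fin n → ℂ} (hz : z ∈ Ω) :
    Tendsto (fun j => extendByZero (berezin (D j)
        (toeplitzPoly fun m i => restrictSymbol (hD j) (φ m i))) z) atTop
      (𝓝 (extendByZero (berezin Ω
        (toeplitzPoly fun m i => restrictSymbol hΩV (φ m i))) z)) := by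
  by_cases hzZ : z ∈ bergmanZeroSet Ω
  · -- the kernels of all `D j` vanish at `z` as well, and both sides are extended by zero there
    rw [extendByZero_of_mem _ hz, berezin_eq_zero_of_mem_bergmanZeroSet _ hzZ]
    refine tendsto_const_nhds.congr fun j => ?_
    rw [extendByZero_of_mem _ (hΩD j hz),
      berezin_eq_zero_of_mem_bergmanZeroSet _ (bergmanZeroSet_mono (hΩD j) hzZ)]
  · refine (tendstoUniformlyOn_berezin_toeplitzPoly hK hD hΩV φ isCompact_singleton
      ?_).tendsto_at (Set.mem_singleton z)
    exact Set.singleton_subset_iff.2 ⟨hz, hzZ⟩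

end Convergence

end BergmanDomains

/-- The sequence is indexed from `0`, so `D 0` plays the role of `Ω₁`, on which the symbols live. -/
theorem mainTheorem5 {n : ℕ} (Ω : TopologicalSpace.Opens (Fin n → ℂ))
    (D : ℕ → TopologicalSpace.Opens (Fin n → ℂ))
    (hΩc : IsConnected (Ω : Set (Fin n → ℂ)))
    (hDc : ∀ j, IsConnected (D j : Set (Fin n → ℂ)))
    (hΩ : bergmanSpace Ω ≠ ⊥)
    (hD : Antitone D) (hΩD : ∀ j, Ω ≤ D j)
    (hK : ∀ z : Ω, Tendsto
      (fun j => bergmanKernel (D j) ⟨z, hΩD j z.2⟩ ⟨z, hΩD j z.2⟩) atTop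
      (𝓝 (bergmanKernel Ω z z)))
    (l : ℕ) (k : Fin l → ℕ) (φ : (m : Fin l) → Fin (k m) → BoundedSymbol (D 0))
    (T : bergmanSpace Ω →L[ℂ] bergmanSpace Ω)
    (hT : T = toeplitzPoly fun m i => restrictSymbol (hΩD 0) (φ m i))
    (TD : (j : ℕ) → bergmanSpace (D j) →L[ℂ] bergmanSpace (D j))
    (hTD : ∀ j, TD j = toeplitzPoly fun m i => restrictSymbol (hD (Nat.zero_le j)) (φ m i)) :
    (∀ K : Set (Fin n → ℂ), IsCompact K → K ⊆ (Ω : Set (Fin n → ℂ)) \ bergmanZeroSet Ω →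
      (∀ᶠ j in atTop, Disjoint K (bergmanZeroSet (D j))) ∧
      TendstoUniformlyOn (fun j => extendByZero (berezin (D j) (TD j)))
        (extendByZero (berezin Ω T)) atTop K) ∧
    (Bornology.IsBounded (D 0 : Set (Fin n → ℂ)) → ∀ p : ℝ, 0 < p →
      MemLp (extendByZero (berezin Ω T)) (ENNReal.ofReal p)
        (volume.restrict (Ω : Set (Fin n → ℂ))) ∧
      (∀ j, MemLp (extendByZero (berezin (D j) (TD j))) (ENNReal.ofReal p)
        (volume.restrict (Ω : Set (Fin n → ℂ)))) ∧
      Tendsto (fun j => eLpNorm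
        (fun z => extendByZero (berezin (D j) (TD j)) z - extendByZero (berezin Ω T) z)
        (ENNReal.ofReal p) (volume.restrict (Ω : Set (Fin n → ℂ)))) atTop (𝓝 0)) := by
  subst hT
  obtain rfl : TD = fun j => _ := funext hTD
  refine ⟨fun K hKc hKΩ => ⟨eventually_disjoint_bergmanZeroSet hK hKc hKΩ,
    tendstoUniformlyOn_berezin_toeplitzPoly hK _ (hΩD 0) φ hKc hKΩ⟩, fun hbdd p hp => ?_⟩
  have : IsFiniteMeasure (volume.restrict (Ω : Set (Fin n → ℂ))) :=
    isFiniteMeasure_restrict.2 (hbdd.subset (hΩD 0)).measure_lt_top.ne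
  -- The constant depends on the symbols on `D 0` alone, so it serves `Ω` and every `D j` at once.
  have hbound {W : TopologicalSpace.Opens (Fin n → ℂ)} (h : W ≤ D 0) :=
    norm_extendByZero_berezin_le (norm_toeplitzPoly_le h φ)
  refine ⟨MemLp.of_bound (measurable_extendByZero_berezin _).aestronglyMeasurable _
      (Eventually.of_forall (hbound (hΩD 0))),
    fun j => MemLp.of_bound (measurable_extendByZero_berezin _).aestronglyMeasurable _
      (Eventually.of_forall (hbound (hD (Nat.zero_le j)))),
    tendsto_eLpNorm_sub_of_bounded (fun j => measurable_extendByZero_berezin _)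
      (measurable_extendByZero_berezin _) (fun j => hbound (hD (Nat.zero_le j)))
      (hbound (hΩD 0)) ?_ hp⟩
  filter_upwards [ae_restrict_mem Ω.isOpen.measurableSet] with z hz
  exact tendsto_extendByZero_berezin_toeplitzPoly hK _ (hΩD 0) φ hz
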